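/- **Proposition 4.3.** Let $F$ be any field. A (right) Leibniz algebra over $F$ is a vector space with a bilinear bracket satisfying $[x,[y,z]]=[[x,y],z]-[[x,z],y]$; write $\mathfrak g^2=[\mathfrak g,\mathfrak g]$ and $Z(\mathfrak g)=\{x : [x,y]=[y,x]=0 \text{ for all } y\in\mathfrak g\}$. For a (two-sided) ideal $\mathfrak n$ of $\mathfrak g$, the second relative Leibniz homology is $HL_2(\mathfrak g,\mathfrak n)=H_3(M_*)$, where $M_*$ is the mapping cone of the chain map $CL_*(\mathfrak g)\to CL_*(\mathfrak g/\mathfrak n)$ induced by the projection, i.e. $M_n=CL_{n-1}(\mathfrak g)\oplus CL_n(\mathfrak g/\mathfrak n)$, with $CL_n(\mathfrak g)=\mathfrak g^{\otimes n}$ and $$\partial_n(x_1\otimes\cdots\otimes x_n)=\sum_{1\le i<j\le n}(-1)^j\,x_1\otimes\cdots\otimes[x_i,x_j]\otimes\cdots\otimes\widehat{x_j}\otimes\cdots\otimes x_n .$$ A finite dimensional nilpotent Leibniz algebra $\mathfrak e$ is called extra special if $\dim Z(\mathfrak e)=\dim\mathfrak e^2=1$. Let $\mathfrak a(q)$ be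 the abelian Leibniz algebra of dimension $q\ge 0$, let $\mathfrak g=\mathfrak e\oplus\mathfrak a(q)$, and let $\mathfrak n$ be an ideal of $\mathfrak g$. (i) If $\mathfrak e$ is extra special and $\mathfrak e^2\subseteq\mathfrak n\subseteq Z(\mathfrak g)$, then $$\dim HL_2(\mathfrak g,\mathfrak n)=2\dim\mathfrak g\,\dim\mathfrak n-(\dim\mathfrak n+1)^2+2 .$$ (ii) Let $J_1=\langle x,y \mid [x,x]=y\rangle$, $J_2=\langle x,y,z\mid [x,y]=z\rangle$, $H_1=\langle x,y,z\mid [x,y]=z=-[y,x]\rangle$ (all other brackets of basis elements being zero), and suppose $\dim\mathfrak n=2$. Then $$\dim HL_2(J_1\oplus\mathfrak a(q),\mathfrak n)=\begin{cases}4q & \text{if } \mathfrak n\subseteq\mathfrak a(q),\text{ or more generally if }\mathfrak n\subseteq Z(\mathfrak g)\text{ and } J_1^2\not\subseteq\mathfrak n,\\ 4q+1 & \text{if } J_1^2\subseteq\mathfrak n\subseteq Z(\mathfrak g),\\ 2q+1 & \text{if } \mathfrak n\not\subseteq Z(\mathfrak g),\end{cases}$$ $$\dim HL_2(J_2\oplus\mathfrak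 a(q),\mathfrak n)=\begin{cases}4(q+1) & \text{if } \mathfrak n\subseteq\mathfrak a(q),\text{ or more generally if }\mathfrak n\subseteq Z(\mathfrak g)\text{ and } J_2^2\not\subseteq\mathfrak n,\\ 4q+5 & \text{if } J_2^2\subseteq\mathfrak n\subseteq Z(\mathfrak g),\\ 2q+3 & \text{if } \mathfrak n\not\subseteq Z(\mathfrak g),\end{cases}$$ $$\dim HL_2(H_1\oplus\mathfrak a(q),\mathfrak n)=\begin{cases}4(q+1) & \text{if } \mathfrak n\subseteq\mathfrak a(q),\text{ or more generally if }\mathfrak n\subseteq Z(\mathfrak g)\text{ and } H_1^2\not\subseteq\mathfrak n,\\ 4q+5 & \text{if } H_1^2\subseteq\mathfrak n\subseteq Z(\mathfrak g),\\ 2(q+2) & \text{if } \mathfrak n\not\subseteq Z(\mathfrak g).\end{cases}$$ -/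

import Mathlib

open scoped TensorProduct

/-- A (right) Leibniz algebra over the field `F`: a bilinear bracket with
`[x, [y, z]] = [[x, y], z] - [[x, z], y]`. -/
class LeibnizAlgebra (F : Type*) (g : Type*) [Field F] [AddCommGroup g] [Module F g] where
  bracket : g →ₗ[F] g →ₗ[F] g
  leibniz : ∀ x y z : g,
    bracket x (bracket y z) = bracket (bracket x y) z - bracket (bracket x z) y

/-- A two-sided ideal of a Leibniz algebra. -/
structure LeibnizIdeal (F : Type*) (g : Type*) [Field F] [AddCommGroup g] [Module F g]
    [LeibnizAlgebra F g] extends Submodule F g where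
  bracket_mem_left : ∀ x y : g, y ∈ toSubmodule → LeibnizAlgebra.bracket (F := F) x y ∈ toSubmodule
  bracket_mem_right : ∀ x y : g, x ∈ toSubmodule → LeibnizAlgebra.bracket (F := F) x y ∈ toSubmodule

namespace LeibnizAlgebra

section Basic

variable (F : Type*) (g : Type*) [Field F] [AddCommGroup g] [Module F g] [LeibnizAlgebra F g]

/-- The (two-sided) centre `Z(g)`. -/
def center : Submodule F g where
  carrier := {x | ∀ y : g, bracket (F := F) x y = 0 ∧ bracket (F := F) y x = 0}
  add_mem' := by
    intro a b ha hb y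
    simp [(ha y).1, (ha y).2, (hb y).1, (hb y).2]
  zero_mem' := by
    intro y
    simp
  smul_mem' := by
    intro c a ha y
    simp [(ha y).1, (ha y).2]

/-- The derived subalgebra `g² = [g, g]`, spanned by all brackets. -/
def derived : Submodule F g :=
  Submodule.span F {z | ∃ x y : g, bracket (F := F) x y = z}

/-- The lower central series `g, [g, g], [[g, g], g], …`. -/
def lowerCentral : ℕ → Submodule F g
  | 0 => ⊤
  | k + 1 => Submodule.span F {z | ∃ x ∈ lowerCentral k, ∃ y : g, bracket (F := F) x y = z}

def IsNilpotent : Prop := ∃ k : ℕ, lowerCentral F g k = ⊥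

def IsAbelian : Prop := ∀ x y : g, bracket (F := F) x y = 0

/-- Extra special: finite dimensional, nilpotent, `dim Z(g) = dim g² = 1`. -/
structure IsExtraSpecial : Prop where
  finiteDimensional : FiniteDimensional F g
  nilpotent : IsNilpotent F g
  finrank_center : Module.finrank F (center F g) = 1
  finrank_derived : Module.finrank F (derived F g) = 1

end Basic

/-- The direct sum of two Leibniz algebras, with componentwise bracket. -/
instance instProd {F g h : Type*} [Field F] [AddCommGroup g] [Module F g] [LeibnizAlgebra F g]
    [AddCommGroup h] [Module F h] [LeibnizAlgebra F h] : LeibnizAlgebra F (g × h) where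
  bracket := LinearMap.mk₂ F
    (fun x y => (bracket (F := F) x.1 y.1, bracket (F := F) x.2 y.2))
    (by intros; simp) (by intros; simp) (by intros; simp) (by intros; simp)
  leibniz x y z := by
    ext
    · exact leibniz x.1 y.1 z.1
    · exact leibniz x.2 y.2 z.2

section Quotient

variable {F g : Type*} [Field F] [AddCommGroup g] [Module F g] [LeibnizAlgebra F g]

/-- The bracket induced on the quotient by an ideal. -/
def quotientBracket (N : LeibnizIdeal F g) :
    (g ⧸ N.toSubmodule) →ₗ[F] (g ⧸ N.toSubmodule) →ₗ[F] (g ⧸ N.toSubmodule) :=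
  N.toSubmodule.liftQ
    { toFun := fun x => N.toSubmodule.mapQ N.toSubmodule (bracket (F := F) x)
        (fun y hy => N.bracket_mem_left x y hy)
      map_add' := by
        intro x y
        ext z
        simp
      map_smul' := by
        intro c x
        ext z
        simp }
    (by
      intro x hx
      rw [LinearMap.mem_ker]
      ext y
      simpa using N.bracket_mem_right x y hx)

instance instQuotient (N : LeibnizIdeal F g) : LeibnizAlgebra F (g ⧸ N.toSubmodule) where
  bracket := quotientBracket N
  leibniz x y z := by
    obtain ⟨x, rfl⟩ := N.toSubmodule.mkQ_surjective x
    obtain ⟨y, rfl⟩ := N.toSubmodule.mkQ_surjective y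
    obtain ⟨z, rfl⟩ := N.toSubmodule.mkQ_surjective z
    exact congrArg N.toSubmodule.mkQ (leibniz x y z)

end Quotient

section Homology

variable (F : Type*) (g : Type*) [Field F] [AddCommGroup g] [Module F g]

/-- The Leibniz chains `CL_n(g) = g^{⊗ n}`. -/
def CL (n : ℕ) : Type _ := ⨂[F] _ : Fin n, g

noncomputable instance instAddCommGroupCL (n : ℕ) : AddCommGroup (CL F g n) :=
  inferInstanceAs (AddCommGroup (⨂[F] _ : Fin n, g))

noncomputable instance instModuleCL (n : ℕ) : Module F (CL F g n) :=
  inferInstanceAs (Module F (⨂[F] _ : Fin n, g))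

/-- The pure tensors `x_0 ⊗ … ⊗ x_{n-1}`. -/
noncomputable def pureTensor (n : ℕ) : MultilinearMap F (fun _ : Fin n => g) (CL F g n) :=
  PiTensorProduct.tprod F

variable [LeibnizAlgebra F g]

/-- The tuple `(x_0, …, [x_i, x_j], …, x_n)` in which `[x_i, x_j]` stands in the place of `x_i`
and the entry `x_j` is omitted. -/
def contract (n : ℕ) (i j : Fin (n + 1)) (x : Fin (n + 1) → g) : Fin n → g :=
  fun k => if j.succAbove k = i then bracket (F := F) (x i) (x j) else x (j.succAbove k)

theorem contract_update (n : ℕ) (i j : Fin (n + 1)) (hij : i ≠ j) (x : Fin (n + 1) → g)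
    (m : Fin (n + 1)) : ∃ (v : Fin n → g) (k : Fin n) (L : g →ₗ[F] g), ∀ c : g,
      contract F g n i j (Function.update x m c) = Function.update v k (L c) := by
  obtain ⟨k₀, hk₀⟩ := Fin.exists_succAbove_eq hij
  have hinj : ∀ k, j.succAbove k = i ↔ k = k₀ := fun k => by
    rw [← hk₀]
    exact Fin.succAbove_right_injective.eq_iff
  by_cases hmj : m = j
  · subst hmj
    refine ⟨fun k => x (m.succAbove k), k₀, bracket (x i), fun c => ?_⟩
    ext k
    by_cases hk : k = k₀ <;> simp [contract, hinj, hk, hij]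
  · obtain ⟨k₁, rfl⟩ := Fin.exists_succAbove_eq hmj
    have hne : j.succAbove k₁ ≠ j := hmj
    by_cases hk₁ : k₁ = k₀
    · subst hk₁
      refine ⟨fun k => x (j.succAbove k), k₁, bracket.flip (x j), fun c => ?_⟩
      ext k
      by_cases hk : k = k₁ <;> simp [contract, hk, hk₀, hij.symm, hinj]
    · have hi : i ≠ j.succAbove k₁ := fun h => hk₁ ((hinj k₁).1 h.symm)
      refine ⟨contract F g n i j x, k₁, LinearMap.id, fun c => ?_⟩
      ext k
      by_cases hk : k = k₁
      · subst hk
        simp [contract, hi.symm]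
      · simp [contract, hk, hi, hne.symm]

/-- For `i ≠ j`, the multilinear map
`x_0 ⊗ … ⊗ x_n ↦ x_0 ⊗ … ⊗ [x_i, x_j] ⊗ … ⊗ (x_j omitted) ⊗ … ⊗ x_n`. -/
noncomputable def boundaryTerm (n : ℕ) (i j : Fin (n + 1)) (hij : i ≠ j) :
    MultilinearMap F (fun _ : Fin (n + 1) => g) (CL F g n) where
  toFun x := pureTensor F g n (contract F g n i j x)
  map_update_add' := by
    intro inst x m a b
    obtain rfl : inst = instDecidableEqFin _ := Subsingleton.elim _ _
    obtain ⟨v, k, L, h⟩ := contract_update F g n i j hij x m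
    simp only [h, map_add, MultilinearMap.map_update_add]
  map_update_smul' := by
    intro inst x m c a
    obtain rfl : inst = instDecidableEqFin _ := Subsingleton.elim _ _
    obtain ⟨v, k, L, h⟩ := contract_update F g n i j hij x m
    simp only [h, map_smul, MultilinearMap.map_update_smul]

/-- The Leibniz boundary `∂_{n+1} : CL_{n+1}(g) → CL_n(g)`. With the positions counted from `0`
(so that the position `j` here is the position `j + 1` counted from `1`) it sends
`x_0 ⊗ … ⊗ x_n` to
`∑_{i < j} (-1)^{j+1} x_0 ⊗ … ⊗ [x_i, x_j] ⊗ … ⊗ (x_j omitted) ⊗ … ⊗ x_n`. -/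
noncomputable def boundary (n : ℕ) : CL F g (n + 1) →ₗ[F] CL F g n :=
  PiTensorProduct.lift (∑ j : Fin (n + 1), ∑ i : Fin (n + 1),
    if h : i < j then (-1 : F) ^ ((j : ℕ) + 1) • boundaryTerm F g n i j h.ne else 0)

variable {F g}

/-- The map `π_n : CL_n(g) → CL_n(g/N)` induced by the projection `g → g/N`. -/
noncomputable def chainProj (N : LeibnizIdeal F g) (n : ℕ) :
    CL F g n →ₗ[F] CL F (g ⧸ N.toSubmodule) n :=
  (PiTensorProduct.map (fun _ => N.toSubmodule.mkQ) :
    (⨂[F] _ : Fin n, g) →ₗ[F] (⨂[F] _ : Fin n, (g ⧸ N.toSubmodule)))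

/-- The boundary `δ_{n+2} : M_{n+2} → M_{n+1}` of the mapping cone `M` of `π_*`, where
`M_k = CL_{k-1}(g) ⊕ CL_k(g/N)` and `δ(a, b) = (-∂ a, ∂ b + π a)`. -/
noncomputable def coneBoundary (N : LeibnizIdeal F g) (n : ℕ) :
    (CL F g (n + 1) × CL F (g ⧸ N.toSubmodule) (n + 2)) →ₗ[F]
      (CL F g n × CL F (g ⧸ N.toSubmodule) (n + 1)) :=
  LinearMap.prod
    (-(boundary F g n ∘ₗ LinearMap.fst F _ _))
    (boundary F (g ⧸ N.toSubmodule) (n + 1) ∘ₗ LinearMap.snd F _ _ +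
      chainProj N (n + 1) ∘ₗ LinearMap.fst F _ _)

/-- The relative Leibniz homology `HL_{n+1}(g, N) = H_{n+2}(M) = ker δ_{n+2} / im δ_{n+3}`. -/
abbrev RelHLSucc (N : LeibnizIdeal F g) (n : ℕ) : Type _ :=
  LinearMap.ker (coneBoundary N n) ⧸
    (LinearMap.range (coneBoundary N (n + 1))).submoduleOf (LinearMap.ker (coneBoundary N n))

/-- The second relative Leibniz homology `HL_2(g, N) = H_3(M)`. -/
abbrev HL2 (N : LeibnizIdeal F g) : Type _ := RelHLSucc N 1

end Homology

/-- `J_1 = ⟨x, y | [x, x] = y⟩`, in coordinates with respect to the basis `x, y`;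
all other brackets of basis elements vanish. -/
def J1 (F : Type*) : Type _ := Fin 2 → F

/-- `J_2 = ⟨x, y, z | [x, y] = z⟩`, in coordinates with respect to the basis `x, y, z`;
all other brackets of basis elements vanish. -/
def J2 (F : Type*) : Type _ := Fin 3 → F

/-- `H_1 = ⟨x, y, z | [x, y] = z = -[y, x]⟩`, in coordinates with respect to the basis `x, y, z`;
all other brackets of basis elements vanish. -/
def H1 (F : Type*) : Type _ := Fin 3 → F

section Examples

variable (F : Type*) [Field F]

instance : AddCommGroup (J1 F) := inferInstanceAs (AddCommGroup (Fin 2 → F))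
instance : Module F (J1 F) := inferInstanceAs (Module F (Fin 2 → F))
instance : AddCommGroup (J2 F) := inferInstanceAs (AddCommGroup (Fin 3 → F))
instance : Module F (J2 F) := inferInstanceAs (Module F (Fin 3 → F))
instance : AddCommGroup (H1 F) := inferInstanceAs (AddCommGroup (Fin 3 → F))
instance : Module F (H1 F) := inferInstanceAs (Module F (Fin 3 → F))

instance : LeibnizAlgebra F (J1 F) where
  bracket := (LinearMap.mk₂ F
    (fun u v => ![0, u 0 * v 0])
    (by intros; ext k; fin_cases k <;> (simp; try ring))
    (by intros; ext k; fin_cases k <;> (simp; try ring))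
    (by intros; ext k; fin_cases k <;> (simp; try ring))
    (by intros; ext k; fin_cases k <;> (simp; try ring)) :
    (Fin 2 → F) →ₗ[F] (Fin 2 → F) →ₗ[F] (Fin 2 → F))
  leibniz x y z := by
    change (![0, x 0 * 0] : Fin 2 → F) = ![0, 0 * z 0] - ![0, 0 * y 0]
    simp

instance : LeibnizAlgebra F (J2 F) where
  bracket := (LinearMap.mk₂ F
    (fun u v => ![0, 0, u 0 * v 1])
    (by intros; ext k; fin_cases k <;> (simp; try ring))
    (by intros; ext k; fin_cases k <;> (simp; try ring))
    (by intros; ext k; fin_cases k <;> (simp; try ring))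
    (by intros; ext k; fin_cases k <;> (simp; try ring)) :
    (Fin 3 → F) →ₗ[F] (Fin 3 → F) →ₗ[F] (Fin 3 → F))
  leibniz x y z := by
    change (![0, 0, x 0 * 0] : Fin 3 → F) = ![0, 0, 0 * z 1] - ![0, 0, 0 * y 1]
    simp

instance : LeibnizAlgebra F (H1 F) where
  bracket := (LinearMap.mk₂ F
    (fun u v => ![0, 0, u 0 * v 1 - u 1 * v 0])
    (by intros; ext k; fin_cases k <;> (simp; try ring))
    (by intros; ext k; fin_cases k <;> (simp; try ring))
    (by intros; ext k; fin_cases k <;> (simp; try ring))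
    (by intros; ext k; fin_cases k <;> (simp; try ring)) :
    (Fin 3 → F) →ₗ[F] (Fin 3 → F) →ₗ[F] (Fin 3 → F))
  leibniz x y z := by
    change (![0, 0, x 0 * 0 - x 1 * 0] : Fin 3 → F) =
      ![0, 0, 0 * z 1 - 0 * z 0] - ![0, 0, 0 * y 1 - 0 * y 0]
    simp

end Examples

end LeibnizAlgebra

/-! Since `CL_*(g) → CL_*(g/n)` is surjective, its mapping cone has, up to a shift, the homology of
the kernel complex `K_*`. Hence `dim HL_2(g, n) = dim K_2 - dim ∂K_3 - dim ∂K_2`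
(`finrank_HL2_add`), and `dim K_2 = (dim g)² - (dim g/n)²`.

In every case the bracket is `[x, y] = B(x, y) z` for a nonzero bilinear form `B` with `z` in both
radicals (`IsCentralBracket`). Then `∂K_2` is zero if `n` is central and is the line of `z`
otherwise. Every boundary of a 3-chain has the form `a ⊗ z + z ⊗ b`, so `∂K_3` is the image of a
subspace `W` of `g × g`, namely `boundaryCoeff`, under `tensorWith z`. The kernel of that map is the
line of `(z, -z)` (`ker_tensorWith`), so `dim ∂K_3` is `dim W`, or `dim W - 1` when `(z, -z)` lies
in `W`.

It remains to find `W`. For central `n` it is `n × n`, and it contains `(z, -z)` exactly when `z ∈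
n`. For noncentral `n` it depends only on `B`: if `B = f ⊗ h` (`J_1`, `J_2`), then `W = g × ker h`;
if `B = f ∧ h` (`H_1`), then `W` consists of the pairs with `b - a ∈ ker f ∩ ker h`. The dimensions
follow by arithmetic. -/

namespace LeibnizAlgebra

/-! ### Pure tensors and chains in low degrees. -/

section Chains

variable {F g : Type*} [Field F] [AddCommGroup g] [Module F g]

theorem span_pureTensor (n : ℕ) :
    Submodule.span F (Set.range (pureTensor F g n)) = ⊤ :=
  PiTensorProduct.span_tprod_eq_top

theorem chain_hom_ext {M : Type*} [AddCommGroup M] [Module F M] {n : ℕ}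
    {φ ψ : CL F g n →ₗ[F] M} (h : ∀ x, φ (pureTensor F g n x) = ψ (pureTensor F g n x)) :
    φ = ψ :=
  LinearMap.ext_on_range (span_pureTensor n) h

theorem pureTensor_two_add_left (a b y : g) :
    pureTensor F g 2 ![a + b, y] = pureTensor F g 2 ![a, y] + pureTensor F g 2 ![b, y] := by
  have h (c : g) : Function.update ![a, y] 0 c = ![c, y] := by
    ext i; fin_cases i <;> rfl
  simpa only [h] using (pureTensor F g 2).map_update_add ![a, y] 0 a b

theorem pureTensor_two_smul_left (c : F) (a y : g) :
    pureTensor F g 2 ![c • a, y] = c • pureTensor F g 2 ![a, y] := by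
  have h (c : g) : Function.update ![a, y] 0 c = ![c, y] := by
    ext i; fin_cases i <;> rfl
  simpa only [h] using (pureTensor F g 2).map_update_smul ![a, y] 0 c a

theorem pureTensor_two_add_right (x a b : g) :
    pureTensor F g 2 ![x, a + b] = pureTensor F g 2 ![x, a] + pureTensor F g 2 ![x, b] := by
  have h (c : g) : Function.update ![x, a] 1 c = ![x, c] := by
    ext i; fin_cases i <;> rfl
  simpa only [h] using (pureTensor F g 2).map_update_add ![x, a] 1 a b

theorem pureTensor_two_smul_right (c : F) (x a : g) :
    pureTensor F g 2 ![x, c • a] = c • pureTensor F g 2 ![x, a] := by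
  have h (c : g) : Function.update ![x, a] 1 c = ![x, c] := by
    ext i; fin_cases i <;> rfl
  simpa only [h] using (pureTensor F g 2).map_update_smul ![x, a] 1 c a

/-- The bilinear map `(x, y) ↦ x ⊗ y` into the Leibniz `2`-chains. -/
noncomputable def tensorTwo : g →ₗ[F] g →ₗ[F] CL F g 2 :=
  LinearMap.mk₂ F (fun x y => pureTensor F g 2 ![x, y]) pureTensor_two_add_left
    pureTensor_two_smul_left pureTensor_two_add_right pureTensor_two_smul_right

theorem pureTensor_two (x : Fin 2 → g) : pureTensor F g 2 x = tensorTwo (x 0) (x 1) :=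
  congrArg _ (by ext i; fin_cases i <;> rfl)

/-- The functionals `φ ⊗ ψ` test relations between 2-chains without a choice of basis. -/
theorem exists_linearMap_tensorTwo (φ ψ : g →ₗ[F] F) :
    ∃ θ : CL F g 2 →ₗ[F] F, ∀ x y, θ (tensorTwo x y) = φ x * ψ y := by
  refine ⟨PiTensorProduct.lift
    ((MultilinearMap.mkPiAlgebra F (Fin 2) F).compLinearMap ![φ, ψ]), fun x y => ?_⟩
  refine (PiTensorProduct.lift.tprod _).trans ?_
  simp

/-- The linear equivalence of `g` with the Leibniz `1`-chains. -/
noncomputable def tensorOne : g ≃ₗ[F] CL F g 1 :=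
  (PiTensorProduct.subsingletonEquiv (R := F) (s := fun _ : Fin 1 => g) (0 : Fin 1)).symm

theorem pureTensor_one (x : Fin 1 → g) : pureTensor F g 1 x = tensorOne (x 0) := by
  exact (LinearEquiv.eq_symm_apply
    (PiTensorProduct.subsingletonEquiv (R := F) (s := fun _ : Fin 1 => g) (0 : Fin 1))).2
    (PiTensorProduct.subsingletonEquiv_apply_tprod (R := F) (s := fun _ : Fin 1 => g) 0 x)

instance finiteDimensional_CL [FiniteDimensional F g] (n : ℕ) : FiniteDimensional F (CL F g n) :=
  Module.Finite.of_basis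
    (Basis.piTensorProduct (fun _ : Fin n => Module.finBasis F g) :
      Module.Basis _ F (⨂[F] _ : Fin n, g))

theorem finrank_CL [FiniteDimensional F g] (n : ℕ) :
    Module.finrank F (CL F g n) = Module.finrank F g ^ n := by
  refine (Module.finrank_eq_card_basis
    (Basis.piTensorProduct (fun _ : Fin n => Module.finBasis F g) :
      Module.Basis _ F (⨂[F] _ : Fin n, g))).trans ?_
  simp

variable [LeibnizAlgebra F g]

/-! ### Explicit boundaries in low degrees, and `∂² = 0`. -/

theorem boundary_pureTensor (n : ℕ) (x : Fin (n + 1) → g) :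
    boundary F g n (pureTensor F g (n + 1) x) = ∑ j : Fin (n + 1), ∑ i : Fin (n + 1),
      if i < j then (-1 : F) ^ ((j : ℕ) + 1) • pureTensor F g n (contract F g n i j x) else 0 := by
  refine (PiTensorProduct.lift.tprod _).trans ?_
  rw [sum_apply]
  refine Finset.sum_congr rfl fun j _ => ?_
  rw [sum_apply]
  refine Finset.sum_congr rfl fun i _ => ?_
  split_ifs <;> rfl

theorem boundary_tensorTwo (x y : g) :
    boundary F g 1 (tensorTwo x y) = tensorOne (bracket (F := F) x y) := by
  have := boundary_pureTensor (F := F) 1 ![x, y]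
  rw [pureTensor_two] at this
  simpa [Fin.sum_univ_two, pureTensor_one, contract] using this

theorem boundary_two_pureTensor (x y z : g) :
    boundary F g 2 (pureTensor F g 3 ![x, y, z]) =
      tensorTwo (bracket (F := F) x y) z - tensorTwo (bracket (F := F) x z) y
        - tensorTwo x (bracket (F := F) y z) := by
  rw [boundary_pureTensor]
  simp [Fin.sum_univ_three, pureTensor_two, contract, Fin.succAbove, pow_succ]
  abel

theorem boundary_three_pureTensor (x y z w : g) :
    boundary F g 3 (pureTensor F g 4 ![x, y, z, w]) =
      pureTensor F g 3 ![bracket (F := F) x y, z, w]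
        - pureTensor F g 3 ![bracket (F := F) x z, y, w]
        - pureTensor F g 3 ![x, bracket (F := F) y z, w]
        + pureTensor F g 3 ![bracket (F := F) x w, y, z]
        + pureTensor F g 3 ![x, bracket (F := F) y w, z]
        + pureTensor F g 3 ![x, y, bracket (F := F) z w] := by
  have h (v : Fin 3 → g) : pureTensor F g 3 v = pureTensor F g 3 ![v 0, v 1, v 2] :=
    congrArg _ (by ext i; fin_cases i <;> rfl)
  rw [boundary_pureTensor]
  simp [Fin.sum_univ_four, h (contract _ _ _ _ _ _), contract, Fin.succAbove, pow_succ]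
  abel

/-- In this degree, `∂² = 0` on pure tensors is exactly the Leibniz identity. -/
theorem boundary_one_boundary_two (c : CL F g 3) : boundary F g 1 (boundary F g 2 c) = 0 := by
  suffices boundary F g 1 ∘ₗ boundary F g 2 = 0 from LinearMap.congr_fun this c
  refine chain_hom_ext fun x => ?_
  have hx : x = ![x 0, x 1, x 2] := by ext i; fin_cases i <;> rfl
  rw [hx, LinearMap.comp_apply, boundary_two_pureTensor]
  simp [boundary_tensorTwo, leibniz (F := F) (g := g)]

theorem boundary_two_boundary_three (c : CL F g 4) : boundary F g 2 (boundary F g 3 c) = 0 := by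
  suffices boundary F g 2 ∘ₗ boundary F g 3 = 0 from LinearMap.congr_fun this c
  refine chain_hom_ext fun x => ?_
  have hx : x = ![x 0, x 1, x 2, x 3] := by ext i; fin_cases i <;> rfl
  generalize x 0 = a at hx
  generalize x 1 = b at hx
  generalize x 2 = c at hx
  generalize x 3 = d at hx
  subst hx
  rw [LinearMap.comp_apply, boundary_three_pureTensor]
  simp only [map_add, map_sub, boundary_two_pureTensor, leibniz (F := F) (g := g),
    LinearMap.sub_apply, LinearMap.zero_apply]
  abel

/-! ### The projection of chains and its kernel. -/

theorem chainProj_pureTensor (N : LeibnizIdeal F g) (n : ℕ) (x : Fin n → g) :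
    chainProj N n (pureTensor F g n x) =
      pureTensor F (g ⧸ N.toSubmodule) n (fun i => N.toSubmodule.mkQ (x i)) :=
  PiTensorProduct.map_tprod _ _

theorem chainProj_surjective (N : LeibnizIdeal F g) (n : ℕ) :
    Function.Surjective (chainProj N n) := by
  rw [← LinearMap.range_eq_top, eq_top_iff, ← span_pureTensor, Submodule.span_le]
  rintro _ ⟨x, rfl⟩
  choose y hy using fun i => N.toSubmodule.mkQ_surjective (x i)
  exact ⟨pureTensor F g n y, by rw [chainProj_pureTensor]; simp only [hy]⟩

theorem boundary_chainProj (N : LeibnizIdeal F g) (n : ℕ) (c : CL F g (n + 1)) :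
    boundary F (g ⧸ N.toSubmodule) n (chainProj N (n + 1) c) =
      chainProj N n (boundary F g n c) := by
  suffices boundary F (g ⧸ N.toSubmodule) n ∘ₗ chainProj N (n + 1) =
    chainProj N n ∘ₗ boundary F g n from LinearMap.congr_fun this c
  refine chain_hom_ext fun x => ?_
  simp only [LinearMap.comp_apply, chainProj_pureTensor, boundary_pureTensor, map_sum]
  refine Finset.sum_congr rfl fun j _ => Finset.sum_congr rfl fun i _ => ?_
  split_ifs
  · rw [map_smul, chainProj_pureTensor]
    congr 2
    ext k
    simp only [contract]
    split_ifs <;> rfl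
  · rw [map_zero]

/-- The kernel of `CL_n(g) → CL_n(g/N)` is spanned by the pure tensors with an entry in `N`. -/
theorem ker_chainProj (N : LeibnizIdeal F g) (n : ℕ) :
    LinearMap.ker (chainProj N n) = Submodule.span F
      {t | ∃ x : Fin n → g, (∃ i, x i ∈ N.toSubmodule) ∧ pureTensor F g n x = t} := by
  set S := Submodule.span F
      {t | ∃ x : Fin n → g, (∃ i, x i ∈ N.toSubmodule) ∧ pureTensor F g n x = t} with hS
  apply le_antisymm
  -- A linear section `s` of `g → g/N` induces `σ` on tensors. On the kernel of the projection `id -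
  -- σ ∘ π` is the identity, so it suffices that this map takes values in `S`.
  · obtain ⟨s, hs⟩ := N.toSubmodule.mkQ.exists_rightInverse_of_surjective N.toSubmodule.range_mkQ
    let σ : CL F (g ⧸ N.toSubmodule) n →ₗ[F] CL F g n :=
      (PiTensorProduct.map (fun _ => s) :
        (⨂[F] _ : Fin n, (g ⧸ N.toSubmodule)) →ₗ[F] (⨂[F] _ : Fin n, g))
    have hσ (x : Fin n → g ⧸ N.toSubmodule) : σ (pureTensor F _ n x) =
      pureTensor F g n (fun i => s (x i)) := PiTensorProduct.map_tprod _ _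
    have hp (x : g) : x - s (N.toSubmodule.mkQ x) ∈ N.toSubmodule := by
      rw [← Submodule.Quotient.mk_eq_zero, Submodule.Quotient.mk_sub, sub_eq_zero]
      exact (LinearMap.congr_fun hs (N.toSubmodule.mkQ x)).symm
    have key : S.mkQ ∘ₗ (LinearMap.id - σ ∘ₗ chainProj N n) = 0 := by
      refine chain_hom_ext fun x => ?_
      simp only [LinearMap.comp_apply, LinearMap.sub_apply, LinearMap.id_apply, LinearMap.zero_apply,
        chainProj_pureTensor, hσ, Submodule.mkQ_apply, Submodule.Quotient.mk_eq_zero]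
      set y : Fin n → g := fun i => s (Submodule.Quotient.mk (x i))
      -- Replace the entries `x i` by `s (π (x i))` one at a time: each replacement changes the
      -- tensor by a pure tensor with an entry `x a - s (π (x a))` in `N`.
      have telescope (T : Finset (Fin n)) :
          pureTensor F g n x - pureTensor F g n (T.piecewise y x) ∈ S := by
        induction T using Finset.induction_on with
        | empty => simp
        | insert a T ha ih =>
          have h1 : T.piecewise y x = Function.update (T.piecewise y x) a (x a) := by
            rw [Function.eq_update_self_iff]
            simp [ha]
          have h2 : pureTensor F g n (T.piecewise y x)
              - pureTensor F g n ((insert a T).piecewise y x) ∈ S := by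
            rw [Finset.piecewise_insert]
            nth_rewrite 1 [h1]
            rw [← MultilinearMap.map_update_sub]
            exact Submodule.subset_span ⟨_, ⟨a, by simpa using hp (x a)⟩, rfl⟩
          simpa using S.add_mem ih h2
      simpa using telescope Finset.univ
    intro c hc
    have := LinearMap.congr_fun key c
    simpa [LinearMap.mem_ker.1 hc, Submodule.Quotient.mk_eq_zero] using this
  · rw [hS, Submodule.span_le]
    rintro _ ⟨x, ⟨i, hi⟩, rfl⟩
    rw [SetLike.mem_coe, LinearMap.mem_ker, chainProj_pureTensor]
    exact MultilinearMap.map_coord_zero _ i (by simpa using hi)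

/-! ### Comparison of the mapping cone with the kernel complex. -/

theorem coneBoundary_apply (N : LeibnizIdeal F g) (n : ℕ) (a : CL F g (n + 1))
    (b : CL F (g ⧸ N.toSubmodule) (n + 2)) : coneBoundary N n (a, b) =
      (-boundary F g n a, boundary F (g ⧸ N.toSubmodule) (n + 1) b + chainProj N (n + 1) a) :=
  rfl

/-- The relative homology `HL_2(g, N)` is the homology of the kernel of `CL_*(g) → CL_*(g/N)`
in degree two. -/
theorem finrank_HL2_add [FiniteDimensional F g] (N : LeibnizIdeal F g) :
    Module.finrank F (HL2 N)
      + Module.finrank F ((LinearMap.ker (chainProj N 3)).map (boundary F g 2))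
      + Module.finrank F ((LinearMap.ker (chainProj N 2)).map (boundary F g 1))
      = Module.finrank F (LinearMap.ker (chainProj N 2)) := by
  set K := LinearMap.ker (chainProj N 2) with hK
  have hrange : (K.map (boundary F g 1)) = LinearMap.range ((boundary F g 1).domRestrict K) := by
    rw [LinearMap.range_domRestrict]
  rw [hrange, ← LinearMap.finrank_range_add_finrank_ker ((boundary F g 1).domRestrict K)]
  set Z := LinearMap.ker ((boundary F g 1).domRestrict K) with hZ
  -- A cycle `c` of the kernel complex gives the cone cycle `(c, 0)`; `j` is its homology class.
  let ι : Z →ₗ[F] LinearMap.ker (coneBoundary N 1) :=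
    LinearMap.codRestrict _ (LinearMap.inl F _ _ ∘ₗ K.subtype ∘ₗ Z.subtype) (by
      rintro ⟨⟨c, hc⟩, hc'⟩
      have h1 : boundary F g 1 c = 0 := hc'
      have h2 : chainProj N 2 c = 0 := hc
      simp [coneBoundary, h1, h2])
  let j : Z →ₗ[F] HL2 N := Submodule.mkQ _ ∘ₗ ι
  -- A cone cycle `(a, π c)` is homologous to `(a + ∂c, 0)`, the difference being the boundary of
  -- `(-c, 0)`.
  have hsurj : Function.Surjective j := by
    intro v
    obtain ⟨⟨⟨a, b⟩, hab⟩, rfl⟩ := Submodule.mkQ_surjective _ v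
    have hab' : boundary F g 1 a = 0 ∧
        boundary F (g ⧸ N.toSubmodule) 2 b + chainProj N 2 a = 0 := by
      simpa [coneBoundary] using hab
    obtain ⟨c, rfl⟩ := chainProj_surjective N 3 b
    refine ⟨⟨⟨a + boundary F g 2 c, ?_⟩, ?_⟩, ?_⟩
    · rw [hK, LinearMap.mem_ker, map_add, ← boundary_chainProj, add_comm]
      exact hab'.2
    · change boundary F g 1 (a + boundary F g 2 c) = 0
      rw [map_add, boundary_one_boundary_two, hab'.1, add_zero]
    · refine (Submodule.Quotient.eq _).2 ⟨(-c, 0), ?_⟩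
      change coneBoundary N 2 (-c, 0) = (a + boundary F g 2 c, 0) - (a, chainProj N 3 c)
      simp [coneBoundary_apply]
  -- If `(w, 0)` is the boundary of `(c, π e)`, then `c + ∂e` lies in the kernel of the projection
  -- and `w = -∂(c + ∂e)`.
  have hker : (LinearMap.ker j).map (K.subtype ∘ₗ Z.subtype) =
      (LinearMap.ker (chainProj N 3)).map (boundary F g 2) := by
    ext v
    constructor
    · rintro ⟨w, hw, rfl⟩
      obtain ⟨⟨c, d⟩, hcd⟩ := (Submodule.Quotient.mk_eq_zero _).1 hw
      obtain ⟨e, rfl⟩ := chainProj_surjective N 4 d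
      have hcd' : -boundary F g 2 c = (w : K) ∧
          boundary F (g ⧸ N.toSubmodule) 3 (chainProj N 4 e) + chainProj N 3 c = 0 := by
        have : coneBoundary N 2 (c, chainProj N 4 e) = (((w : K) : CL F g 2), 0) := hcd
        simpa [coneBoundary_apply] using this
      refine ⟨-(c + boundary F g 3 e), ?_, ?_⟩
      · rw [SetLike.mem_coe, LinearMap.mem_ker, map_neg, map_add, ← boundary_chainProj, add_comm,
          hcd'.2, neg_zero]
      · rw [map_neg, map_add, boundary_two_boundary_three, add_zero]
        exact hcd'.1
    · rintro ⟨c, hc, rfl⟩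
      refine ⟨⟨⟨boundary F g 2 c, ?_⟩, ?_⟩, ?_, rfl⟩
      · rw [hK, LinearMap.mem_ker, ← boundary_chainProj, LinearMap.mem_ker.1 hc, map_zero]
      · exact boundary_one_boundary_two c
      · refine (Submodule.Quotient.mk_eq_zero _).2 ⟨(-c, 0), ?_⟩
        change coneBoundary N 2 (-c, 0) = (boundary F g 2 c, 0)
        simp [coneBoundary_apply, LinearMap.mem_ker.1 hc]
  have hinj : Function.Injective (K.subtype ∘ₗ Z.subtype) :=
    K.injective_subtype.comp Z.injective_subtype
  have hfin := (Submodule.equivMapOfInjective _ hinj (LinearMap.ker j)).finrank_eq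
  have hrank := LinearMap.finrank_range_add_finrank_ker j
  rw [LinearMap.range_eq_top.2 hsurj, finrank_top] at hrank
  rw [← hker, ← hfin, hrank]
  ring

end Chains

/-! ### Dimension counts for subspaces. -/

theorem finrank_map_add_finrank_inf_ker {F V W : Type*} [Field F] [AddCommGroup V] [Module F V]
    [AddCommGroup W] [Module F W] [FiniteDimensional F V] (f : V →ₗ[F] W) (S : Submodule F V) :
    Module.finrank F (S.map f) + Module.finrank F (S ⊓ LinearMap.ker f : Submodule F V) =
      Module.finrank F S := by
  have h := LinearMap.finrank_range_add_finrank_ker (f.domRestrict S)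
  rw [LinearMap.range_domRestrict] at h
  rw [← h, ← Submodule.map_comap_subtype]
  congr 1
  exact Submodule.finrank_map_subtype_eq S _

theorem finrank_submodule_prod {F V W : Type*} [Field F] [AddCommGroup V] [Module F V]
    [AddCommGroup W] [Module F W] [FiniteDimensional F V] [FiniteDimensional F W]
    (p : Submodule F V) (q : Submodule F W) :
    Module.finrank F (p.prod q) = Module.finrank F p + Module.finrank F q := by
  rw [← Module.finrank_prod]
  exact LinearEquiv.finrank_eq
    { toFun := fun x => (⟨x.1.1, x.2.1⟩, ⟨x.1.2, x.2.2⟩)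
      invFun := fun x => ⟨(x.1, x.2), x.1.2, x.2.2⟩
      map_add' := fun _ _ => rfl
      map_smul' := fun _ _ => rfl }

/-! ### Brackets with values in a central line. -/

section BoundaryCoeff

variable {F g : Type*} [Field F] [AddCommGroup g] [Module F g]

/-- The coefficients of the boundaries `∂(u ⊗ v ⊗ w)` with respect to `tensorWith`. -/
def boundaryCoeff (N : Submodule F g) (B : g →ₗ[F] g →ₗ[F] F) : Submodule F (g × g) :=
  Submodule.span F {p | ∃ u v w : g, (u ∈ N ∨ v ∈ N ∨ w ∈ N) ∧
    (-(B v w • u), B u v • w - B u w • v) = p}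

theorem mem_boundaryCoeff {N : Submodule F g} (B : g →ₗ[F] g →ₗ[F] F) {u v w : g}
    (h : u ∈ N ∨ v ∈ N ∨ w ∈ N) :
    (-(B v w • u), B u v • w - B u w • v) ∈ boundaryCoeff N B :=
  Submodule.subset_span ⟨u, v, w, h, rfl⟩

end BoundaryCoeff

section RankOne

variable {F g : Type*} [Field F] [AddCommGroup g] [Module F g]

/-- The map `(a, b) ↦ a ⊗ z + z ⊗ b`. -/
noncomputable def tensorWith (z : g) : g × g →ₗ[F] CL F g 2 :=
  (tensorTwo.flip z).coprod (tensorTwo z)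

theorem tensorWith_apply (z a b : g) :
    tensorWith z (a, b) = tensorTwo (F := F) a z + tensorTwo z b := rfl

/-- Take `f` with `f z ≠ 0`. Applying `φ ⊗ f` and `f ⊗ φ` to `a ⊗ z + z ⊗ b = 0` for all `φ` forces
`a` and `b` to be multiples of `z`; applying `f ⊗ f` makes the coefficients opposite. -/
theorem ker_tensorWith {z : g} (hz : z ≠ 0) :
    LinearMap.ker (tensorWith (F := F) z) = Submodule.span F {(z, -z)} := by
  apply le_antisymm
  · rintro ⟨a, b⟩ hab
    obtain ⟨f, hf⟩ := Module.Projective.exists_dual_ne_zero F hz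
    have key (φ ψ : g →ₗ[F] F) : φ a * ψ z + φ z * ψ b = 0 := by
      obtain ⟨θ, hθ⟩ := exists_linearMap_tensorTwo φ ψ
      rw [← hθ, ← hθ, ← map_add]
      exact (congrArg θ hab).trans θ.map_zero
    have ha : a = (-(f b) / f z) • z := by
      rw [← sub_eq_zero, ← Module.forall_dual_apply_eq_zero_iff F]
      intro φ
      have := key φ f
      rw [map_sub, map_smul, smul_eq_mul]
      field_simp
      linear_combination this
    have hb : b = (-(f a) / f z) • z := by
      rw [← sub_eq_zero, ← Module.forall_dual_apply_eq_zero_iff F]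
      intro φ
      have := key f φ
      rw [map_sub, map_smul, smul_eq_mul]
      field_simp
      linear_combination this
    refine Submodule.mem_span_singleton.2 ⟨-(f b) / f z, ?_⟩
    have hfa : f a = - f b := by
      have := key f f
      apply mul_right_cancel₀ hf
      linear_combination this
    rw [hfa, neg_neg] at hb
    refine Prod.ext ha.symm ?_
    conv_rhs => rw [hb]
    simp [neg_div]
  · rw [Submodule.span_singleton_le_iff_mem, LinearMap.mem_ker, tensorWith_apply]
    simp

theorem finrank_map_tensorWith_of_mem [FiniteDimensional F g] {z : g} (hz : z ≠ 0)
    {W : Submodule F (g × g)} (hW : (z, -z) ∈ W) :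
    Module.finrank F (W.map (tensorWith z)) + 1 = Module.finrank F W := by
  have hne : ((z, -z) : g × g) ≠ 0 := fun h => hz (congrArg Prod.fst h)
  rw [← finrank_map_add_finrank_inf_ker (tensorWith z) W, ker_tensorWith hz,
    inf_eq_right.2 ((Submodule.span_singleton_le_iff_mem _ _).2 hW), finrank_span_singleton hne]

theorem finrank_map_tensorWith_of_notMem [FiniteDimensional F g] {z : g} (hz : z ≠ 0)
    {W : Submodule F (g × g)} (hW : (z, -z) ∉ W) :
    Module.finrank F (W.map (tensorWith z)) = Module.finrank F W := by
  have hdisj : W ⊓ LinearMap.ker (tensorWith (F := F) z) = ⊥ := by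
    rw [ker_tensorWith hz, ← disjoint_iff]
    exact Submodule.disjoint_span_singleton_of_notMem hW
  rw [← finrank_map_add_finrank_inf_ker (tensorWith z) W, hdisj, finrank_bot, add_zero]

variable [LeibnizAlgebra F g]

theorem finrank_ker_chainProj_two [FiniteDimensional F g] (N : LeibnizIdeal F g) :
    (Module.finrank F (LinearMap.ker (chainProj N 2)) : ℤ) =
      2 * Module.finrank F g * Module.finrank F N.toSubmodule
        - (Module.finrank F N.toSubmodule : ℤ) ^ 2 := by
  have h1 := LinearMap.finrank_range_add_finrank_ker (chainProj N 2)
  rw [LinearMap.range_eq_top.2 (chainProj_surjective N 2), finrank_top, finrank_CL, finrank_CL] at h1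
  have h2 := N.toSubmodule.finrank_quotient_add_finrank
  zify at h1 h2
  rw [← h2] at h1 ⊢
  linear_combination h1

/-- `z` spans the brackets of `g`: the bracket is `z` times a bilinear form that has `z` in both
radicals. -/
structure IsCentralBracket (z : g) (B : g →ₗ[F] g →ₗ[F] F) : Prop where
  ne_zero : z ≠ 0
  bracket_eq : ∀ x y : g, bracket (F := F) x y = B x y • z
  apply_left : ∀ x, B z x = 0
  apply_right : ∀ x, B x z = 0

namespace IsCentralBracket

variable {z : g} {B : g →ₗ[F] g →ₗ[F] F}

/-- Each of the three terms of `∂(u ⊗ v ⊗ w)` contains one bracket, hence a factor `z`. Collecting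
the terms with `z` on the right and on the left gives the two coordinates in `boundaryCoeff`. -/
theorem map_boundary_two (hB : IsCentralBracket z B) (N : LeibnizIdeal F g) :
    (LinearMap.ker (chainProj N 3)).map (boundary F g 2) =
      (boundaryCoeff N.toSubmodule B).map (tensorWith z) := by
  have key (u v w : g) : boundary F g 2 (pureTensor F g 3 ![u, v, w]) =
      tensorWith z (-(B v w • u), B u v • w - B u w • v) := by
    rw [boundary_two_pureTensor, tensorWith_apply]
    simp only [hB.bracket_eq, map_smul, map_neg, map_sub, LinearMap.smul_apply, LinearMap.neg_apply]
    abel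
  rw [ker_chainProj, boundaryCoeff, Submodule.map_span, Submodule.map_span]
  congr 1
  ext t
  constructor
  · rintro ⟨_, ⟨x, ⟨i, hi⟩, rfl⟩, rfl⟩
    have hx : x = ![x 0, x 1, x 2] := by ext i; fin_cases i <;> rfl
    refine ⟨_, ⟨x 0, x 1, x 2, ?_, rfl⟩, ?_⟩
    · fin_cases i
      exacts [Or.inl hi, Or.inr (Or.inl hi), Or.inr (Or.inr hi)]
    · rw [← key, ← hx]
  · rintro ⟨_, ⟨u, v, w, h, rfl⟩, rfl⟩
    refine ⟨_, ⟨![u, v, w], ?_, rfl⟩, key u v w⟩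
    rcases h with h | h | h
    · exact ⟨0, h⟩
    · exact ⟨1, h⟩
    · exact ⟨2, h⟩

theorem mem_center_iff (hB : IsCentralBracket z B) (x : g) :
    x ∈ center F g ↔ ∀ y, B x y = 0 ∧ B y x = 0 := by
  change (∀ y : g, bracket (F := F) x y = 0 ∧ bracket (F := F) y x = 0) ↔ _
  simp [hB.bracket_eq, hB.ne_zero]

theorem map_boundary_one_of_central (N : LeibnizIdeal F g)
    (hN : N.toSubmodule ≤ center F g) :
    (LinearMap.ker (chainProj N 2)).map (boundary F g 1) = ⊥ := by
  rw [ker_chainProj, Submodule.map_span, Submodule.span_eq_bot]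
  rintro _ ⟨_, ⟨x, ⟨i, hi⟩, rfl⟩, rfl⟩
  rw [pureTensor_two, boundary_tensorTwo, LinearEquiv.map_eq_zero_iff]
  fin_cases i
  · exact (hN hi _).1
  · exact (hN hi _).2

theorem exists_of_not_central (hB : IsCentralBracket z B) (N : LeibnizIdeal F g)
    (hN : ¬ N.toSubmodule ≤ center F g) :
    ∃ n ∈ N.toSubmodule, ∃ m, B n m ≠ 0 ∨ B m n ≠ 0 := by
  obtain ⟨n, hn, hnc⟩ := SetLike.not_le_iff_exists.1 hN
  rw [hB.mem_center_iff] at hnc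
  push Not at hnc
  obtain ⟨m, hm⟩ := hnc
  exact ⟨n, hn, m, or_iff_not_imp_left.2 fun h => hm (not_not.1 h)⟩

theorem map_boundary_one_of_not_central (hB : IsCentralBracket z B) (N : LeibnizIdeal F g)
    (hN : ¬ N.toSubmodule ≤ center F g) :
    Module.finrank F ((LinearMap.ker (chainProj N 2)).map (boundary F g 1)) = 1 := by
  have hz : (tensorOne z : CL F g 1) ≠ 0 := by
    simpa using hB.ne_zero
  suffices h : (LinearMap.ker (chainProj N 2)).map (boundary F g 1) =
      Submodule.span F {tensorOne z} by
    rw [h, finrank_span_singleton hz]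
  rw [ker_chainProj, Submodule.map_span]
  apply le_antisymm
  · rw [Submodule.span_le]
    rintro _ ⟨_, ⟨x, -, rfl⟩, rfl⟩
    rw [pureTensor_two, boundary_tensorTwo, hB.bracket_eq, map_smul]
    exact Submodule.smul_mem _ _ (Submodule.mem_span_singleton_self _)
  · rw [Submodule.span_singleton_le_iff_mem]
    -- Dividing `∂(x ⊗ y) = B(x, y) z` by its coefficient yields `z`.
    have key {x y : g} (hxy : x ∈ N.toSubmodule ∨ y ∈ N.toSubmodule) (h : B x y ≠ 0) :
        tensorOne z ∈ Submodule.span F (boundary F g 1 ''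
          {t | ∃ x : Fin 2 → g, (∃ i, x i ∈ N.toSubmodule) ∧ pureTensor F g 2 x = t}) := by
      rw [← Submodule.smul_mem_iff _ h, ← map_smul, ← hB.bracket_eq, ← boundary_tensorTwo]
      refine Submodule.subset_span ⟨_, ⟨![x, y], ?_, rfl⟩, rfl⟩
      rcases hxy with hxy | hxy
      · exact ⟨0, hxy⟩
      · exact ⟨1, hxy⟩
    obtain ⟨n, hn, m, h | h⟩ := hB.exists_of_not_central N hN
    · exact key (Or.inl hn) h
    · exact key (Or.inr hn) h

/-! ### Central ideals. -/

/-- An entry in `N` is killed by `B` on both sides, so only the term in which it stands outside `B`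
survives. Conversely, if `B u v ≠ 0`, the triples `(a, u, v)` and `(u, v, b)` give multiples of `(a,
0)` and `(0, b)`. -/
theorem boundaryCoeff_of_central (hB : IsCentralBracket z B) (hB0 : B ≠ 0) (N : LeibnizIdeal F g)
    (hN : N.toSubmodule ≤ center F g) :
    boundaryCoeff N.toSubmodule B = N.toSubmodule.prod N.toSubmodule := by
  have hl {n : g} (hn : n ∈ N.toSubmodule) (y : g) : B n y = 0 :=
    ((hB.mem_center_iff n).1 (hN hn) y).1
  have hr {n : g} (hn : n ∈ N.toSubmodule) (y : g) : B y n = 0 :=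
    ((hB.mem_center_iff n).1 (hN hn) y).2
  apply le_antisymm
  · rw [boundaryCoeff, Submodule.span_le]
    rintro _ ⟨u, v, w, h | h | h, rfl⟩
    · simp [hl h, h, Submodule.smul_mem]
    · simp [hl h, hr h, h, Submodule.smul_mem]
    · simp [hr h, h, Submodule.smul_mem]
  · obtain ⟨u, v, huv⟩ : ∃ u v, B u v ≠ 0 := by
      by_contra! h
      exact hB0 (LinearMap.ext₂ h)
    rintro ⟨a, b⟩ ⟨ha, hb⟩
    have h1 := mem_boundaryCoeff B (u := a) (v := u) (w := v) (Or.inl ha)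
    have h2 := mem_boundaryCoeff B (u := u) (v := v) (w := b) (Or.inr (Or.inr hb))
    simp only [hl ha, hr hb, zero_smul, sub_zero, neg_zero] at h1 h2
    rw [← neg_mem_iff] at h1
    have h3 := add_mem ((boundaryCoeff _ B).smul_mem (B u v)⁻¹ h1)
      ((boundaryCoeff _ B).smul_mem (B u v)⁻¹ h2)
    simpa [smul_smul, huv] using h3

theorem finrank_HL2_of_mem [FiniteDimensional F g] (hB : IsCentralBracket z B) (hB0 : B ≠ 0)
    (N : LeibnizIdeal F g) (hN : N.toSubmodule ≤ center F g) (hz : z ∈ N.toSubmodule) :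
    (Module.finrank F (HL2 N) : ℤ) =
      2 * Module.finrank F g * Module.finrank F N.toSubmodule
        - ((Module.finrank F N.toSubmodule : ℤ) + 1) ^ 2 + 2 := by
  have h1 := finrank_HL2_add N
  have h2 := finrank_ker_chainProj_two N
  rw [map_boundary_one_of_central N hN, finrank_bot, hB.map_boundary_two,
    hB.boundaryCoeff_of_central hB0 N hN] at h1
  have h3 := finrank_map_tensorWith_of_mem (W := N.toSubmodule.prod N.toSubmodule) hB.ne_zero
    ⟨hz, neg_mem hz⟩
  rw [finrank_submodule_prod] at h3
  zify at h1 h3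
  linear_combination h1 + h2 - h3

theorem finrank_HL2_of_notMem [FiniteDimensional F g] (hB : IsCentralBracket z B) (hB0 : B ≠ 0)
    (N : LeibnizIdeal F g) (hN : N.toSubmodule ≤ center F g) (hz : z ∉ N.toSubmodule) :
    (Module.finrank F (HL2 N) : ℤ) =
      2 * Module.finrank F g * Module.finrank F N.toSubmodule
        - (Module.finrank F N.toSubmodule : ℤ) ^ 2 - 2 * Module.finrank F N.toSubmodule := by
  have h1 := finrank_HL2_add N
  have h2 := finrank_ker_chainProj_two N
  rw [map_boundary_one_of_central N hN, finrank_bot, hB.map_boundary_two,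
    hB.boundaryCoeff_of_central hB0 N hN] at h1
  have h3 := finrank_map_tensorWith_of_notMem (W := N.toSubmodule.prod N.toSubmodule) hB.ne_zero
    (fun h => hz h.1)
  rw [finrank_submodule_prod] at h3
  zify at h1 h3
  linear_combination h1 + h2 - h3

/-! ### Noncentral ideals, `B = f ⊗ h`. -/

/-- The vector `B(u, v) w - B(u, w) v = f(u) (h(v) w - h(w) v)` is killed by `h`. For the converse,
take `B p r ≠ 0` with `p` or `r` in `N`: the triples `(p, r, b)` with `h b = 0` produce `0 × ker h`,
and then the triples `(a, p, r)` produce `g × 0`. -/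
theorem boundaryCoeff_of_rankOne (hB : IsCentralBracket z B) {f h : g →ₗ[F] F}
    (hfh : ∀ x y, B x y = f x * h y) (N : LeibnizIdeal F g)
    (hN : ¬ N.toSubmodule ≤ center F g) :
    boundaryCoeff N.toSubmodule B = Submodule.prod ⊤ (LinearMap.ker h) := by
  set V := boundaryCoeff N.toSubmodule B with hV
  apply le_antisymm
  · rw [hV, boundaryCoeff, Submodule.span_le]
    rintro _ ⟨u, v, w, -, rfl⟩
    refine ⟨trivial, ?_⟩
    simp only [SetLike.mem_coe, LinearMap.mem_ker, map_sub, map_smul, hfh, smul_eq_mul]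
    ring
  · obtain ⟨p, r, hpr, hN'⟩ : ∃ p r, B p r ≠ 0 ∧ (p ∈ N.toSubmodule ∨ r ∈ N.toSubmodule) := by
      obtain ⟨n, hn, m, h | h⟩ := hB.exists_of_not_central N hN
      exacts [⟨n, m, h, Or.inl hn⟩, ⟨m, n, h, Or.inr hn⟩]
    have hright {b : g} (hb : h b = 0) : ((0, b) : g × g) ∈ V := by
      have := mem_boundaryCoeff B (u := p) (v := r) (w := b)
        (hN'.imp_right Or.inl)
      rw [← Submodule.smul_mem_iff _ hpr]
      simpa [hfh, hb] using this
    rintro ⟨a, b⟩ ⟨-, hb⟩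
    have h1 := mem_boundaryCoeff B (u := a) (v := p) (w := r) (Or.inr hN')
    have h2 : ((0, B a p • r - B a r • p) : g × g) ∈ V := by
      apply hright
      simp only [map_sub, map_smul, hfh, smul_eq_mul]
      ring
    have h3 : ((a, 0) : g × g) ∈ V := by
      rw [← Submodule.smul_mem_iff _ (neg_ne_zero.2 hpr)]
      simpa using sub_mem h1 h2
    simpa using add_mem h3 (hright hb)

theorem finrank_HL2_of_rankOne [FiniteDimensional F g] (hB : IsCentralBracket z B)
    {f h : g →ₗ[F] F} (hfh : ∀ x y, B x y = f x * h y) (N : LeibnizIdeal F g)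
    (hN : ¬ N.toSubmodule ≤ center F g) :
    (Module.finrank F (HL2 N) : ℤ) =
      2 * Module.finrank F g * Module.finrank F N.toSubmodule
        - (Module.finrank F N.toSubmodule : ℤ) ^ 2 - 2 * Module.finrank F g + 1 := by
  -- Noncentrality makes `f` and `h` nonzero, so `h` is surjective, and `B p z = 0` gives `h z = 0`.
  obtain ⟨p, r, hpr⟩ : ∃ p r, f p * h r ≠ 0 := by
    obtain ⟨n, hn, m, h | h⟩ := hB.exists_of_not_central N hN
    exacts [⟨n, m, hfh n m ▸ h⟩, ⟨m, n, hfh m n ▸ h⟩]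
  have hz : h z = 0 := by
    have := hB.apply_right p
    rw [hfh] at this
    exact (mul_eq_zero.1 this).resolve_left (left_ne_zero_of_mul hpr)
  have hsurj : Function.Surjective h :=
    LinearMap.surjective fun h0 => right_ne_zero_of_mul hpr (by simp [h0])
  have h1 := finrank_HL2_add N
  have h2 := finrank_ker_chainProj_two N
  rw [hB.map_boundary_one_of_not_central N hN, hB.map_boundary_two,
    hB.boundaryCoeff_of_rankOne hfh N hN] at h1
  have h3 := finrank_map_tensorWith_of_mem (W := (⊤ : Submodule F g).prod (LinearMap.ker h)) hB.ne_zero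
    ⟨trivial, by simp [hz]⟩
  rw [finrank_submodule_prod, finrank_top] at h3
  have h4 := LinearMap.finrank_range_add_finrank_ker h
  rw [LinearMap.range_eq_top.2 hsurj, finrank_top, Module.finrank_self] at h4
  zify at h1 h3 h4
  linear_combination h1 + h2 - h3 - h4

/-! ### Noncentral ideals, `B = f ∧ h`. -/

/-- For a generator `(a, b)`, the difference `b - a` is `B(u, v) w - B(u, w) v + B(v, w) u`;
applying `f` or `h` gives a 3 × 3 determinant with a repeated row. Conversely, triples `(p, r, b)`
produce `0 × (ker f ∩ ker h)`, and modulo these the triples `(a, p, r)` produce the diagonal. -/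
theorem boundaryCoeff_of_alternating (hB : IsCentralBracket z B) {f h : g →ₗ[F] F}
    (hfh : ∀ x y, B x y = f x * h y - h x * f y) (N : LeibnizIdeal F g)
    (hN : ¬ N.toSubmodule ≤ center F g) :
    boundaryCoeff N.toSubmodule B = LinearMap.ker
      ((f.prod h) ∘ₗ (LinearMap.snd F g g - LinearMap.fst F g g)) := by
  set V := boundaryCoeff N.toSubmodule B with hV
  have hcoeff (u v w : g) : (-(B v w • u), B u v • w - B u w • v) ∈ LinearMap.ker
      ((f.prod h) ∘ₗ (LinearMap.snd F g g - LinearMap.fst F g g)) := by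
    simp only [LinearMap.mem_ker, LinearMap.comp_apply, LinearMap.sub_apply, LinearMap.snd_apply,
      LinearMap.fst_apply, LinearMap.prod_apply, Function.prod, map_sub, map_neg, map_smul, hfh,
      Prod.smul_mk, Prod.mk_sub_mk, Prod.neg_mk, smul_eq_mul, Prod.mk_eq_zero]
    constructor <;> ring
  apply le_antisymm
  · rw [hV, boundaryCoeff, Submodule.span_le]
    rintro _ ⟨u, v, w, -, rfl⟩
    exact hcoeff u v w
  · obtain ⟨p, r, hpr, hN'⟩ : ∃ p r, B p r ≠ 0 ∧ (p ∈ N.toSubmodule ∨ r ∈ N.toSubmodule) := by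
      obtain ⟨n, hn, m, h | h⟩ := hB.exists_of_not_central N hN
      exacts [⟨n, m, h, Or.inl hn⟩, ⟨m, n, h, Or.inr hn⟩]
    have hright {b : g} (hfb : f b = 0) (hb : h b = 0) : ((0, b) : g × g) ∈ V := by
      have := mem_boundaryCoeff B (u := p) (v := r) (w := b)
        (hN'.imp_right Or.inl)
      rw [← Submodule.smul_mem_iff _ hpr]
      simpa [hfh, hb, hfb] using this
    have hdiff {a b : g} (hab : (a, b) ∈ LinearMap.ker
        ((f.prod h) ∘ₗ (LinearMap.snd F g g - LinearMap.fst F g g))) :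
        ((0, b - a) : g × g) ∈ V := by
      have : f (b - a) = 0 ∧ h (b - a) = 0 := by simpa using hab
      exact hright this.1 this.2
    rintro ⟨a, b⟩ hab
    have h1 := mem_boundaryCoeff B (u := a) (v := p) (w := r) (Or.inr hN')
    -- Subtracting `(0, b - a)` from a generator `(a, b)` leaves a diagonal element, here `-B(p, r)
    -- (a, a)`.
    have h2 := sub_mem h1 (hdiff (hcoeff a p r))
    have h3 : ((a, a) : g × g) ∈ V := by
      rw [← Submodule.smul_mem_iff _ (neg_ne_zero.2 hpr)]
      simpa using h2
    simpa using add_mem h3 (hdiff hab)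

theorem finrank_HL2_of_alternating [FiniteDimensional F g] (hB : IsCentralBracket z B)
    {f h : g →ₗ[F] F} (hfh : ∀ x y, B x y = f x * h y - h x * f y)
    (hsurj : Function.Surjective (f.prod h)) (N : LeibnizIdeal F g)
    (hN : ¬ N.toSubmodule ≤ center F g) :
    (Module.finrank F (HL2 N) : ℤ) =
      2 * Module.finrank F g * Module.finrank F N.toSubmodule
        - (Module.finrank F N.toSubmodule : ℤ) ^ 2 - 2 * Module.finrank F g + 2 := by
  have hz : f z = 0 ∧ h z = 0 := by
    obtain ⟨p, hp⟩ := hsurj (1, 0)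
    obtain ⟨r, hr⟩ := hsurj (0, 1)
    simp only [LinearMap.prod_apply, Function.prod, Prod.mk.injEq] at hp hr
    have h1 := hB.apply_left p
    have h2 := hB.apply_left r
    simp_all
  have h1 := finrank_HL2_add N
  have h2 := finrank_ker_chainProj_two N
  rw [hB.map_boundary_one_of_not_central N hN, hB.map_boundary_two,
    hB.boundaryCoeff_of_alternating hfh N hN] at h1
  have h3 := finrank_map_tensorWith_of_mem (F := F) (W := LinearMap.ker
    ((f.prod h) ∘ₗ (LinearMap.snd F g g - LinearMap.fst F g g))) hB.ne_zero
    (by simp [hz])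
  have hsurj' : Function.Surjective
      ((f.prod h) ∘ₗ (LinearMap.snd F g g - LinearMap.fst F g g)) := by
    intro y
    obtain ⟨x, rfl⟩ := hsurj y
    exact ⟨(0, x), by simp⟩
  have h4 := LinearMap.finrank_range_add_finrank_ker
    ((f.prod h) ∘ₗ (LinearMap.snd F g g - LinearMap.fst F g g))
  rw [LinearMap.range_eq_top.2 hsurj', finrank_top, Module.finrank_prod, Module.finrank_prod,
    Module.finrank_self] at h4
  zify at h1 h3 h4
  linear_combination h1 + h2 - h3 - h4

end IsCentralBracket

end RankOne

/-! ### Direct sums with an abelian algebra. -/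

section DirectSum

variable {F E A : Type*} [Field F] [AddCommGroup E] [Module F E] [AddCommGroup A] [Module F A]

theorem compl₁₂_fst_ne_zero {B : E →ₗ[F] E →ₗ[F] F} (hB : B ≠ 0) :
    B.compl₁₂ (LinearMap.fst F E A) (LinearMap.fst F E A) ≠ 0 := by
  intro h
  refine hB (LinearMap.ext₂ fun x y => ?_)
  exact LinearMap.congr_fun₂ h ((x, 0) : E × A) (y, 0)

variable [LeibnizAlgebra F E]

theorem derived_eq_span_of_bracket {z : E} {B : E →ₗ[F] E →ₗ[F] F}
    (hB : ∀ x y : E, bracket (F := F) x y = B x y • z) (hB0 : B ≠ 0) :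
    derived F E = Submodule.span F {z} := by
  apply le_antisymm
  · rw [derived, Submodule.span_le]
    rintro _ ⟨x, y, rfl⟩
    rw [hB]
    exact Submodule.smul_mem _ _ (Submodule.mem_span_singleton_self _)
  · obtain ⟨u, v, huv⟩ : ∃ u v, B u v ≠ 0 := by
      by_contra! h
      exact hB0 (LinearMap.ext₂ h)
    rw [Submodule.span_singleton_le_iff_mem, ← Submodule.smul_mem_iff _ huv, ← hB]
    exact Submodule.subset_span ⟨u, v, rfl⟩

theorem derived_prod_bot_le_iff {z : E} {B : E →ₗ[F] E →ₗ[F] F}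
    (hB : ∀ x y : E, bracket (F := F) x y = B x y • z) (hB0 : B ≠ 0)
    (N : Submodule F (E × A)) :
    Submodule.prod (derived F E) ⊥ ≤ N ↔ (z, 0) ∈ N := by
  rw [derived_eq_span_of_bracket hB hB0]
  constructor
  · intro h
    exact h ⟨Submodule.mem_span_singleton_self _, rfl⟩
  · rintro h ⟨x, y⟩ ⟨hx, hy⟩
    obtain ⟨c, rfl⟩ := Submodule.mem_span_singleton.1 hx
    obtain rfl : y = 0 := hy
    simpa using N.smul_mem c h

theorem not_derived_prod_bot_le {z : E} {B : E →ₗ[F] E →ₗ[F] F} (hB : IsCentralBracket z B)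
    (hB0 : B ≠ 0) {N : Submodule F (E × A)} (hN : N ≤ Submodule.prod ⊥ ⊤) :
    ¬ Submodule.prod (derived F E) (⊥ : Submodule F A) ≤ N := by
  rw [derived_prod_bot_le_iff hB.bracket_eq hB0]
  exact fun h => hB.ne_zero (hN h).1

variable [LeibnizAlgebra F A]

theorem bracket_prod (hA : IsAbelian F A) (x y : E × A) :
    bracket (F := F) x y = (bracket (F := F) x.1 y.1, 0) :=
  Prod.ext rfl (hA x.2 y.2)

theorem IsCentralBracket.prod (hA : IsAbelian F A) {z : E} {B : E →ₗ[F] E →ₗ[F] F}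
    (hB : IsCentralBracket z B) :
    IsCentralBracket ((z, 0) : E × A)
      (B.compl₁₂ (LinearMap.fst F E A) (LinearMap.fst F E A)) where
  ne_zero h := hB.ne_zero (congrArg Prod.fst h)
  bracket_eq x y := by
    rw [bracket_prod hA, hB.bracket_eq]
    simp
  apply_left x := hB.apply_left x.1
  apply_right x := hB.apply_right x.1

theorem le_center_of_le_bot_prod (hA : IsAbelian F A) {N : Submodule F (E × A)}
    (hN : N ≤ Submodule.prod ⊥ ⊤) : N ≤ center F (E × A) := by
  intro x hx y
  have h : x.1 = 0 := (hN hx).1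
  simp [bracket_prod hA, h]

/-- The relative homology of a direct sum with an abelian algebra, for a central ideal that does not
contain the derived subalgebra. -/
theorem finrank_HL2_prod_of_not_derived_le [FiniteDimensional F E] [FiniteDimensional F A]
    (hA : IsAbelian F A) {z : E} {B : E →ₗ[F] E →ₗ[F] F} (hB : IsCentralBracket z B)
    (hB0 : B ≠ 0) (N : LeibnizIdeal F (E × A)) (hN : N.toSubmodule ≤ center F (E × A))
    (hz : ¬ Submodule.prod (derived F E) (⊥ : Submodule F A) ≤ N.toSubmodule) :
    (Module.finrank F (HL2 N) : ℤ) =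
      2 * (Module.finrank F E + Module.finrank F A) * Module.finrank F N.toSubmodule
        - (Module.finrank F N.toSubmodule : ℤ) ^ 2 - 2 * Module.finrank F N.toSubmodule := by
  rw [derived_prod_bot_le_iff hB.bracket_eq hB0] at hz
  rw [(hB.prod hA).finrank_HL2_of_notMem (compl₁₂_fst_ne_zero hB0) N hN hz, Module.finrank_prod]
  push_cast
  ring

theorem finrank_HL2_prod_of_derived_le [FiniteDimensional F E] [FiniteDimensional F A]
    (hA : IsAbelian F A) {z : E} {B : E →ₗ[F] E →ₗ[F] F} (hB : IsCentralBracket z B)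
    (hB0 : B ≠ 0) (N : LeibnizIdeal F (E × A)) (hN : N.toSubmodule ≤ center F (E × A))
    (hz : Submodule.prod (derived F E) (⊥ : Submodule F A) ≤ N.toSubmodule) :
    (Module.finrank F (HL2 N) : ℤ) =
      2 * (Module.finrank F E + Module.finrank F A) * Module.finrank F N.toSubmodule
        - ((Module.finrank F N.toSubmodule : ℤ) + 1) ^ 2 + 2 := by
  rw [derived_prod_bot_le_iff hB.bracket_eq hB0] at hz
  rw [(hB.prod hA).finrank_HL2_of_mem (compl₁₂_fst_ne_zero hB0) N hN hz, Module.finrank_prod]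
  push_cast
  ring

/-- The form is the bracket followed by a functional normalised to take the value 1 at a generator
`z` of the line `E²`. It is nonzero, since otherwise `E²` would vanish. -/
theorem exists_bilinForm_of_finrank_derived (h : Module.finrank F (derived F E) = 1) :
    ∃ z : E, z ∈ derived F E ∧ z ≠ 0 ∧ ∃ B : E →ₗ[F] E →ₗ[F] F, B ≠ 0 ∧
      ∀ x y : E, bracket (F := F) x y = B x y • z := by
  obtain ⟨⟨z, hz⟩, hz0, hspan⟩ := finrank_eq_one_iff'.1 h
  have hz0' : z ≠ 0 := fun h => hz0 (Subtype.ext h)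
  obtain ⟨f, hf⟩ := Module.Projective.exists_dual_ne_zero F hz0'
  have hB (x y : E) : bracket (F := F) x y =
      (bracket (F := F) (g := E)).compr₂ ((f z)⁻¹ • f) x y • z := by
    obtain ⟨c, hc⟩ := hspan ⟨bracket (F := F) x y, Submodule.subset_span ⟨x, y, rfl⟩⟩
    have hc' : c • z = bracket (F := F) x y := congrArg Subtype.val hc
    rw [LinearMap.compr₂_apply, ← hc']
    simp [hf, mul_comm c]
  refine ⟨z, hz, hz0', _, fun h0 => hz0' ?_, hB⟩
  rw [h0] at hB
  have : derived F E ≤ ⊥ := by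
    rw [derived, Submodule.span_le]
    rintro _ ⟨x, y, rfl⟩
    rw [hB]
    simp
  exact (Submodule.mem_bot F).1 (this hz)

/-- The chain `E² ⊆ N ⊆ Z(E × A)` makes the generator `z` of `E²` central, which puts it in both
radicals of `B`. -/
theorem finrank_HL2_of_finrank_derived [FiniteDimensional F E] [FiniteDimensional F A]
    (hA : IsAbelian F A) (hE : Module.finrank F (derived F E) = 1) (N : LeibnizIdeal F (E × A))
    (hz : Submodule.prod (derived F E) (⊥ : Submodule F A) ≤ N.toSubmodule)
    (hN : N.toSubmodule ≤ center F (E × A)) :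
    (Module.finrank F (HL2 N) : ℤ) =
      2 * Module.finrank F (E × A) * Module.finrank F N.toSubmodule
        - ((Module.finrank F N.toSubmodule : ℤ) + 1) ^ 2 + 2 := by
  obtain ⟨z, hzd, hz0, B, hB0, hB⟩ := exists_bilinForm_of_finrank_derived hE
  have hzc (x : E) : bracket (F := F) z x = 0 ∧ bracket (F := F) x z = 0 := by
    have h : ((z, 0) : E × A) ∈ center F (E × A) := hN (hz ⟨hzd, rfl⟩)
    exact ⟨congrArg Prod.fst (h (x, 0)).1, congrArg Prod.fst (h (x, 0)).2⟩
  have hC : IsCentralBracket z B :=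
    { ne_zero := hz0
      bracket_eq := hB
      apply_left := fun x => by
        have := (hzc x).1
        rw [hB] at this
        exact (smul_eq_zero.1 this).resolve_right hz0
      apply_right := fun x => by
        have := (hzc x).2
        rw [hB] at this
        exact (smul_eq_zero.1 this).resolve_right hz0 }
  rw [finrank_HL2_prod_of_derived_le hA hC hB0 N hN hz, Module.finrank_prod]
  push_cast
  ring

end DirectSum

/-! ### The bilinear forms of `J_1`, `J_2` and `H_1`. -/

section Examples

variable (F : Type*) [Field F]

instance : FiniteDimensional F (J1 F) := inferInstanceAs (FiniteDimensional F (Fin 2 → F))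
instance : FiniteDimensional F (J2 F) := inferInstanceAs (FiniteDimensional F (Fin 3 → F))
instance : FiniteDimensional F (H1 F) := inferInstanceAs (FiniteDimensional F (Fin 3 → F))

theorem finrank_J1 : Module.finrank F (J1 F) = 2 := Module.finrank_fin_fun F
theorem finrank_J2 : Module.finrank F (J2 F) = 3 := Module.finrank_fin_fun F
theorem finrank_H1 : Module.finrank F (H1 F) = 3 := Module.finrank_fin_fun F

namespace J1

/-- The `i`-th coordinate. -/
def coord (i : Fin 2) : J1 F →ₗ[F] F := (LinearMap.proj i : (Fin 2 → F) →ₗ[F] F)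

/-- The bilinear form of the bracket. -/
def form : J1 F →ₗ[F] J1 F →ₗ[F] F := (LinearMap.mul F F).compl₁₂ (coord F 0) (coord F 0)

/-- The basis vector `y`. -/
def y : J1 F := (![0, 1] : Fin 2 → F)

theorem isCentralBracket : IsCentralBracket (y F) (form F) where
  ne_zero h := one_ne_zero (α := F) (congrFun h (1 : Fin 2))
  bracket_eq u v := by
    change (![0, u 0 * v 0] : Fin 2 → F) = (u 0 * v 0) • (![0, 1] : Fin 2 → F)
    simp
  apply_left u := zero_mul _
  apply_right u := mul_zero _

theorem form_ne_zero : form F ≠ 0 := by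
  intro h
  have : (1 : F) * 1 = 0 := LinearMap.congr_fun₂ h (![1, 0] : Fin 2 → F) (![1, 0] : Fin 2 → F)
  simp at this

end J1

namespace J2

/-- The `i`-th coordinate. -/
def coord (i : Fin 3) : J2 F →ₗ[F] F := (LinearMap.proj i : (Fin 3 → F) →ₗ[F] F)

/-- The bilinear form of the bracket. -/
def form : J2 F →ₗ[F] J2 F →ₗ[F] F := (LinearMap.mul F F).compl₁₂ (coord F 0) (coord F 1)

/-- The basis vector `z`. -/
def z : J2 F := (![0, 0, 1] : Fin 3 → F)

theorem isCentralBracket : IsCentralBracket (z F) (form F) where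
  ne_zero h := one_ne_zero (α := F) (congrFun h (2 : Fin 3))
  bracket_eq u v := by
    change (![0, 0, u 0 * v 1] : Fin 3 → F) = (u 0 * v 1) • (![0, 0, 1] : Fin 3 → F)
    simp
  apply_left u := zero_mul _
  apply_right u := mul_zero _

theorem form_ne_zero : form F ≠ 0 := by
  intro h
  have : (1 : F) * 1 = 0 := LinearMap.congr_fun₂ h (![1, 0, 0] : Fin 3 → F) (![0, 1, 0] : Fin 3 → F)
  simp at this

end J2

namespace H1

/-- The `i`-th coordinate. -/
def coord (i : Fin 3) : H1 F →ₗ[F] F := (LinearMap.proj i : (Fin 3 → F) →ₗ[F] F)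

/-- The bilinear form of the bracket. -/
def form : H1 F →ₗ[F] H1 F →ₗ[F] F :=
  (LinearMap.mul F F).compl₁₂ (coord F 0) (coord F 1) -
    (LinearMap.mul F F).compl₁₂ (coord F 1) (coord F 0)

/-- The basis vector `z`. -/
def z : H1 F := (![0, 0, 1] : Fin 3 → F)

theorem form_apply (u v : H1 F) :
    form F u v = coord F 0 u * coord F 1 v - coord F 1 u * coord F 0 v := rfl

theorem isCentralBracket : IsCentralBracket (z F) (form F) where
  ne_zero h := one_ne_zero (α := F) (congrFun h (2 : Fin 3))
  bracket_eq u v := by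
    change (![0, 0, u 0 * v 1 - u 1 * v 0] : Fin 3 → F) =
      (u 0 * v 1 - u 1 * v 0) • (![0, 0, 1] : Fin 3 → F)
    simp
  apply_left u := by
    have h0 : coord F 0 (z F) = 0 := rfl
    have h1 : coord F 1 (z F) = 0 := rfl
    rw [form_apply, h0, h1, zero_mul, zero_mul, sub_zero]
  apply_right u := by
    have h0 : coord F 0 (z F) = 0 := rfl
    have h1 : coord F 1 (z F) = 0 := rfl
    rw [form_apply, h0, h1, mul_zero, mul_zero, sub_zero]

theorem form_ne_zero : form F ≠ 0 := by
  intro h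
  have : (1 : F) * 1 - 0 * 0 = 0 :=
    LinearMap.congr_fun₂ h (![1, 0, 0] : Fin 3 → F) (![0, 1, 0] : Fin 3 → F)
  simp at this

end H1

end Examples

end LeibnizAlgebra
-- Assembly of the cases.
open LeibnizAlgebra in
theorem proposition4p3 {F : Type*} [Field F]
    -- `A` is the abelian Leibniz algebra `a(q)`
    {A : Type*} [AddCommGroup A] [Module F A] [LeibnizAlgebra F A] [FiniteDimensional F A]
    (hA : LeibnizAlgebra.IsAbelian F A) (q : ℕ) (hq : Module.finrank F A = q)
    {E : Type*} [AddCommGroup E] [Module F E] [LeibnizAlgebra F E] :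
    -- part (i)
    (LeibnizAlgebra.IsExtraSpecial F E → ∀ N : LeibnizIdeal F (E × A),
      Submodule.prod (LeibnizAlgebra.derived F E) (⊥ : Submodule F A) ≤ N.toSubmodule →
      N.toSubmodule ≤ LeibnizAlgebra.center F (E × A) →
      (Module.finrank F (LeibnizAlgebra.HL2 N) : ℤ) =
        2 * Module.finrank F (E × A) * Module.finrank F N.toSubmodule
          - ((Module.finrank F N.toSubmodule : ℤ) + 1) ^ 2 + 2) ∧
    -- part (ii)
    (∀ N : LeibnizIdeal F (LeibnizAlgebra.J1 F × A), Module.finrank F N.toSubmodule = 2 →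
      (N.toSubmodule ≤ Submodule.prod (⊥ : Submodule F (LeibnizAlgebra.J1 F)) (⊤ : Submodule F A) →
        Module.finrank F (LeibnizAlgebra.HL2 N) = 4 * q) ∧
      (N.toSubmodule ≤ LeibnizAlgebra.center F (LeibnizAlgebra.J1 F × A) →
        ¬ Submodule.prod (LeibnizAlgebra.derived F (LeibnizAlgebra.J1 F)) (⊥ : Submodule F A)
          ≤ N.toSubmodule →
        Module.finrank F (LeibnizAlgebra.HL2 N) = 4 * q) ∧
      (Submodule.prod (LeibnizAlgebra.derived F (LeibnizAlgebra.J1 F)) (⊥ : Submodule F A)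
          ≤ N.toSubmodule →
        N.toSubmodule ≤ LeibnizAlgebra.center F (LeibnizAlgebra.J1 F × A) →
        Module.finrank F (LeibnizAlgebra.HL2 N) = 4 * q + 1) ∧
      (¬ N.toSubmodule ≤ LeibnizAlgebra.center F (LeibnizAlgebra.J1 F × A) →
        Module.finrank F (LeibnizAlgebra.HL2 N) = 2 * q + 1)) ∧
    (∀ N : LeibnizIdeal F (LeibnizAlgebra.J2 F × A), Module.finrank F N.toSubmodule = 2 →
      (N.toSubmodule ≤ Submodule.prod (⊥ : Submodule F (LeibnizAlgebra.J2 F)) (⊤ : Submodule F A) →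
        Module.finrank F (LeibnizAlgebra.HL2 N) = 4 * (q + 1)) ∧
      (N.toSubmodule ≤ LeibnizAlgebra.center F (LeibnizAlgebra.J2 F × A) →
        ¬ Submodule.prod (LeibnizAlgebra.derived F (LeibnizAlgebra.J2 F)) (⊥ : Submodule F A)
          ≤ N.toSubmodule →
        Module.finrank F (LeibnizAlgebra.HL2 N) = 4 * (q + 1)) ∧
      (Submodule.prod (LeibnizAlgebra.derived F (LeibnizAlgebra.J2 F)) (⊥ : Submodule F A)
          ≤ N.toSubmodule →
        N.toSubmodule ≤ LeibnizAlgebra.center F (LeibnizAlgebra.J2 F × A) →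
        Module.finrank F (LeibnizAlgebra.HL2 N) = 4 * q + 5) ∧
      (¬ N.toSubmodule ≤ LeibnizAlgebra.center F (LeibnizAlgebra.J2 F × A) →
        Module.finrank F (LeibnizAlgebra.HL2 N) = 2 * q + 3)) ∧
    (∀ N : LeibnizIdeal F (LeibnizAlgebra.H1 F × A), Module.finrank F N.toSubmodule = 2 →
      (N.toSubmodule ≤ Submodule.prod (⊥ : Submodule F (LeibnizAlgebra.H1 F)) (⊤ : Submodule F A) →
        Module.finrank F (LeibnizAlgebra.HL2 N) = 4 * (q + 1)) ∧
      (N.toSubmodule ≤ LeibnizAlgebra.center F (LeibnizAlgebra.H1 F × A) →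
        ¬ Submodule.prod (LeibnizAlgebra.derived F (LeibnizAlgebra.H1 F)) (⊥ : Submodule F A)
          ≤ N.toSubmodule →
        Module.finrank F (LeibnizAlgebra.HL2 N) = 4 * (q + 1)) ∧
      (Submodule.prod (LeibnizAlgebra.derived F (LeibnizAlgebra.H1 F)) (⊥ : Submodule F A)
          ≤ N.toSubmodule →
        N.toSubmodule ≤ LeibnizAlgebra.center F (LeibnizAlgebra.H1 F × A) →
        Module.finrank F (LeibnizAlgebra.HL2 N) = 4 * q + 5) ∧
      (¬ N.toSubmodule ≤ LeibnizAlgebra.center F (LeibnizAlgebra.H1 F × A) →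
        Module.finrank F (LeibnizAlgebra.HL2 N) = 2 * (q + 2))) := by
  refine ⟨fun hE N hz hN => ?_, fun N hN2 => ?_, fun N hN2 => ?_, fun N hN2 => ?_⟩
  · have := hE.finiteDimensional
    exact finrank_HL2_of_finrank_derived hA hE.finrank_derived N hz hN
  · have hB := J1.isCentralBracket F
    have hB0 := J1.form_ne_zero F
    have hcentral (hN : N.toSubmodule ≤ center F (J1 F × A))
        (hz : ¬ Submodule.prod (derived F (J1 F)) (⊥ : Submodule F A) ≤ N.toSubmodule) :
        (Module.finrank F (HL2 N) : ℤ) = 4 * (2 + q) - 8 := by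
      rw [finrank_HL2_prod_of_not_derived_le hA hB hB0 N hN hz, finrank_J1, hq, hN2]
      push_cast
      ring
    refine ⟨fun hN => ?_, fun hN hz => ?_, fun hz hN => ?_, fun hN => ?_⟩
    -- An ideal inside the abelian summand is central and misses `z`, so this is an instance of the
    -- next case.
    · have := hcentral (le_center_of_le_bot_prod hA hN) (not_derived_prod_bot_le hB hB0 hN)
      lia
    · have := hcentral hN hz
      lia
    · have := finrank_HL2_prod_of_derived_le hA hB hB0 N hN hz
      rw [finrank_J1, hq, hN2] at this
      push_cast at this
      lia
    -- For `J_1` both factors of the form are the `x`-coordinate.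
    · have := (hB.prod hA).finrank_HL2_of_rankOne (f := (J1.coord F 0) ∘ₗ LinearMap.fst F _ _)
        (h := (J1.coord F 0) ∘ₗ LinearMap.fst F _ _) (fun _ _ => rfl) N hN
      rw [Module.finrank_prod, finrank_J1, hq, hN2] at this
      push_cast at this
      lia
  · have hB := J2.isCentralBracket F
    have hB0 := J2.form_ne_zero F
    have hcentral (hN : N.toSubmodule ≤ center F (J2 F × A))
        (hz : ¬ Submodule.prod (derived F (J2 F)) (⊥ : Submodule F A) ≤ N.toSubmodule) :
        (Module.finrank F (HL2 N) : ℤ) = 4 * (3 + q) - 8 := by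
      rw [finrank_HL2_prod_of_not_derived_le hA hB hB0 N hN hz, finrank_J2, hq, hN2]
      push_cast
      ring
    refine ⟨fun hN => ?_, fun hN hz => ?_, fun hz hN => ?_, fun hN => ?_⟩
    · have := hcentral (le_center_of_le_bot_prod hA hN) (not_derived_prod_bot_le hB hB0 hN)
      lia
    · have := hcentral hN hz
      lia
    · have := finrank_HL2_prod_of_derived_le hA hB hB0 N hN hz
      rw [finrank_J2, hq, hN2] at this
      push_cast at this
      lia
    · have := (hB.prod hA).finrank_HL2_of_rankOne (f := (J2.coord F 0) ∘ₗ LinearMap.fst F _ _)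
        (h := (J2.coord F 1) ∘ₗ LinearMap.fst F _ _) (fun _ _ => rfl) N hN
      rw [Module.finrank_prod, finrank_J2, hq, hN2] at this
      push_cast at this
      lia
  · have hB := H1.isCentralBracket F
    have hB0 := H1.form_ne_zero F
    have hcentral (hN : N.toSubmodule ≤ center F (H1 F × A))
        (hz : ¬ Submodule.prod (derived F (H1 F)) (⊥ : Submodule F A) ≤ N.toSubmodule) :
        (Module.finrank F (HL2 N) : ℤ) = 4 * (3 + q) - 8 := by
      rw [finrank_HL2_prod_of_not_derived_le hA hB hB0 N hN hz, finrank_H1, hq, hN2]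
      push_cast
      ring
    refine ⟨fun hN => ?_, fun hN hz => ?_, fun hz hN => ?_, fun hN => ?_⟩
    · have := hcentral (le_center_of_le_bot_prod hA hN) (not_derived_prod_bot_le hB hB0 hN)
      lia
    · have := hcentral hN hz
      lia
    · have := finrank_HL2_prod_of_derived_le hA hB hB0 N hN hz
      rw [finrank_H1, hq, hN2] at this
      push_cast at this
      lia
    -- The form of `H_1` is the wedge of the `x`- and `y`-coordinates, which are jointly surjective.
    -- The joint kernel has codimension 2 instead of 1, hence one dimension more than for `J_2`.
    · have := (hB.prod hA).finrank_HL2_of_alternating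
        (f := (H1.coord F 0) ∘ₗ LinearMap.fst F _ _)
        (h := (H1.coord F 1) ∘ₗ LinearMap.fst F _ _) (fun _ _ => rfl)
        (fun y => ⟨((![y.1, y.2, 0] : Fin 3 → F), 0), rfl⟩) N hN
      rw [Module.finrank_prod, finrank_H1, hq, hN2] at this
      push_cast at this
      lia
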